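/- Let $\mathbb{K}$ be $\mathbb{R}$ or $\mathbb{C}$, and let $A\in\mathbb{K}^{m\times n}$ have rank $k\ge 1$, with singular value decomposition $A=W\Sigma V^*$ ($W\in\mathbb{K}^{m\times m}$ and $V\in\mathbb{K}^{n\times n}$ unitary, singular values in decreasing order). Let $W_k$ and $V_k$ consist of the first $k$ columns of $W$ and of $V$, and define the column and row leverage scores \[ p_j^{\mathrm{lev},k}=\frac1k\|V_k(j,:)\|_2^2,\quad 1\le j\le n,\qquad q_i^{\mathrm{lev},k}=\frac1k\|W_k(i,:)\|_2^2,\quad 1\le i\le m. \] Let $\delta\in(0,1)$ and $\beta_1,\beta_2\in(0,1]$, and let $\widetilde p$ and $\widetilde q$ be probability distributions on $\{1,\dots,n\}$ and $\{1,\dots,m\}$ such that $\widetilde p_j\ge\beta_1 p_j^{\mathrm{lev},k}$ for all $j$ and $\widetilde q_i\ge\beta_2 q_i^{\mathrm{lev},k}$ for all $i$. Let $\ell_1,\ell_2$ be natural numbers with \[ \ell_t\ \ge\ \frac{8}{\beta_t}\Bigl(\log(2k)+\frac1\delta\Bigr)k,\qquad t=1,2. \] Draw column indices $J=(j_1,\dots,j_{\ell_1})$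 independently with replacement according to $\widetilde p$ and, independently of these, row indices $I=(i_1,\dots,i_{\ell_2})$ independently with replacement according to $\widetilde q$. Put $C=A(:,J)\in\mathbb{K}^{m\times\ell_1}$, $R=A(I,:)\in\mathbb{K}^{\ell_2\times n}$ and $U=A(I,J)\in\mathbb{K}^{\ell_2\times\ell_1}$ (repetitions kept), and let $U^\dagger$ be the Moore--Penrose pseudoinverse of $U$. Then \[ \mathbb{P}\bigl(A=CU^\dagger R\bigr)\ \ge\ \bigl(1-2e^{-1/\delta}\bigr)^2. \] -/

import Mathlib

open scoped Matrix

namespace CURSampling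

section PseudoInverse

variable {𝕂 : Type*} [RCLike 𝕂] {m n : Type*} [Fintype m] [Fintype n]

/-- The four Penrose equations: `X` is a Moore-Penrose pseudoinverse of `A`. -/
structure IsMoorePenrose (A : Matrix m n 𝕂) (X : Matrix n m 𝕂) : Prop where
  mul_mul_left : A * X * A = A
  mul_mul_right : X * A * X = X
  herm_left : (A * X)ᴴ = A * X
  herm_right : (X * A)ᴴ = X * A

theorem IsMoorePenrose.unique {A : Matrix m n 𝕂} {X Y : Matrix n m 𝕂}
    (hX : IsMoorePenrose A X) (hY : IsMoorePenrose A Y) : X = Y := by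
  have h1 : A * X = A * Y := by
    calc A * X = (A * X)ᴴ := hX.herm_left.symm
      _ = ((A * Y) * (A * X))ᴴ := by rw [← Matrix.mul_assoc, hY.mul_mul_left]
      _ = (A * X)ᴴ * (A * Y)ᴴ := Matrix.conjTranspose_mul _ _
      _ = A * X * (A * Y) := by rw [hX.herm_left, hY.herm_left]
      _ = A * Y := by rw [← Matrix.mul_assoc, hX.mul_mul_left]
  have h2 : X * A = Y * A := by
    calc X * A = (X * A)ᴴ := hX.herm_right.symm
      _ = ((X * A) * (Y * A))ᴴ := by
          rw [Matrix.mul_assoc X A, ← Matrix.mul_assoc A Y, hY.mul_mul_left]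
      _ = (Y * A)ᴴ * (X * A)ᴴ := Matrix.conjTranspose_mul _ _
      _ = Y * A * (X * A) := by rw [hX.herm_right, hY.herm_right]
      _ = Y * A := by rw [Matrix.mul_assoc Y A, ← Matrix.mul_assoc A X, hX.mul_mul_left]
  calc X = X * A * X := hX.mul_mul_right.symm
    _ = Y * A * Y := by rw [h2, Matrix.mul_assoc, h1, Matrix.mul_assoc]
    _ = Y := hY.mul_mul_right

open scoped ComplexOrder in
theorem exists_isMoorePenrose (A : Matrix m n 𝕂) : ∃ X, IsMoorePenrose A X := by
  classical
  have hH : (Aᴴ * A).IsHermitian := Matrix.isHermitian_conjTranspose_mul_self A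
  obtain ⟨G, hG, h1, h2, h3⟩ : ∃ G : Matrix n n 𝕂, Gᴴ = G ∧
      (Aᴴ * A) * G * (Aᴴ * A) = Aᴴ * A ∧ G * (Aᴴ * A) * G = G ∧
      (G * (Aᴴ * A))ᴴ = G * (Aᴴ * A) := by
    set V : Matrix n n 𝕂 := (hH.eigenvectorUnitary : Matrix n n 𝕂) with hV
    have hVV : Vᴴ * V = 1 := Matrix.mem_unitaryGroup_iff'.1 hH.eigenvectorUnitary.2
    set d : n → 𝕂 := fun i => (hH.eigenvalues i : 𝕂) with hd
    have hs : Aᴴ * A = V * Matrix.diagonal d * Vᴴ := by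
      have := hH.spectral_theorem
      rw [Unitary.conjStarAlgAut_apply] at this
      exact this
    have key : ∀ a b : n → 𝕂, (V * Matrix.diagonal a * Vᴴ) * (V * Matrix.diagonal b * Vᴴ)
        = V * Matrix.diagonal (fun i => a i * b i) * Vᴴ := by
      intro a b
      calc _ = V * Matrix.diagonal a * (Vᴴ * V) * Matrix.diagonal b * Vᴴ := by
            simp only [Matrix.mul_assoc]
        _ = _ := by
            rw [hVV, Matrix.mul_one, Matrix.mul_assoc V, Matrix.diagonal_mul_diagonal]
    have hstar : ∀ a : n → 𝕂, (∀ i, star (a i) = a i) →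
        (V * Matrix.diagonal a * Vᴴ)ᴴ = V * Matrix.diagonal a * Vᴴ := by
      intro a ha
      rw [Matrix.conjTranspose_mul, Matrix.conjTranspose_mul, Matrix.conjTranspose_conjTranspose,
        Matrix.diagonal_conjTranspose, Matrix.mul_assoc]
      congr 3
      funext i
      exact ha i
    refine ⟨V * Matrix.diagonal (fun i => (d i)⁻¹) * Vᴴ, hstar _ ?_, ?_, ?_, ?_⟩
    · intro i; simp [hd]
    · rw [hs, key, key]
      congr 3
      funext i
      by_cases h : d i = 0 <;> simp [h]
    · rw [hs, key, key]
      congr 3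
      funext i
      by_cases h : d i = 0 <;> simp [h]
    · rw [hs, key]
      apply hstar
      intro i
      simp [hd, mul_comm]
  have hA : A * (G * (Aᴴ * A)) = A := by
    have h0 : (A * (G * (Aᴴ * A)) - A)ᴴ * (A * (G * (Aᴴ * A)) - A) = 0 := by
      have e1 : Aᴴ * (A * (G * (Aᴴ * A)) - A) = 0 := by
        rw [Matrix.mul_sub, ← Matrix.mul_assoc, ← Matrix.mul_assoc, h1, sub_self]
      have e2 : (A * (G * (Aᴴ * A)) - A)ᴴ = (G * (Aᴴ * A))ᴴ * Aᴴ - Aᴴ := by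
        rw [Matrix.conjTranspose_sub, Matrix.conjTranspose_mul]
      rw [e2, Matrix.sub_mul, Matrix.mul_assoc, e1, Matrix.mul_zero, sub_zero]
    exact sub_eq_zero.1 (Matrix.conjTranspose_mul_self_eq_zero.1 h0)
  refine ⟨G * Aᴴ, ?_, ?_, ?_, ?_⟩
  · simpa only [Matrix.mul_assoc] using hA
  · have := congrArg (· * Aᴴ) h2
    simpa only [Matrix.mul_assoc] using this
  · rw [Matrix.conjTranspose_mul, Matrix.conjTranspose_mul, Matrix.conjTranspose_conjTranspose, hG,
      Matrix.mul_assoc]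
  · simpa only [Matrix.mul_assoc] using h3

/-- The Moore-Penrose pseudoinverse `A†`. -/
noncomputable def pinv (A : Matrix m n 𝕂) : Matrix n m 𝕂 :=
  (exists_isMoorePenrose A).choose

theorem pinv_spec (A : Matrix m n 𝕂) : IsMoorePenrose A (pinv A) :=
  (exists_isMoorePenrose A).choose_spec

end PseudoInverse

section Leverage

variable {𝕂 : Type*} [RCLike 𝕂] {m n : ℕ}

/-- The rectangular `m × n` matrix with `σ` along its diagonal. -/
def rectDiagonal (𝕂 : Type*) [RCLike 𝕂] {m n : ℕ} (σ : Fin (min m n) → ℝ) :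
    Matrix (Fin m) (Fin n) 𝕂 :=
  fun i j => if h : i.val = j.val then
    ((σ ⟨i.val, lt_min i.isLt (h ▸ j.isLt)⟩ : ℝ) : 𝕂) else 0

/-- A (full) singular value decomposition `A = W Σ V*`, singular values in decreasing order. -/
structure SVD (A : Matrix (Fin m) (Fin n) 𝕂) where
  W : Matrix (Fin m) (Fin m) 𝕂
  V : Matrix (Fin n) (Fin n) 𝕂
  σ : Fin (min m n) → ℝ
  W_unitary : W ∈ Matrix.unitaryGroup (Fin m) 𝕂
  V_unitary : V ∈ Matrix.unitaryGroup (Fin n) 𝕂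
  σ_antitone : Antitone σ
  σ_nonneg : ∀ i, 0 ≤ σ i
  eq_mul : A = W * rectDiagonal 𝕂 σ * Vᴴ

theorem SVD.nonempty (A : Matrix (Fin m) (Fin n) 𝕂) : Nonempty (SVD A) := by
  classical
  set L : EuclideanSpace 𝕂 (Fin n) →ₗ[𝕂] EuclideanSpace 𝕂 (Fin m) := Matrix.toEuclideanLin A with hL
  set T : EuclideanSpace 𝕂 (Fin n) →ₗ[𝕂] EuclideanSpace 𝕂 (Fin n) := L.adjoint ∘ₗ L with hT
  have hTs : T.IsSymmetric := L.isSymmetric_adjoint_comp_self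
  have hn : Module.finrank 𝕂 (EuclideanSpace 𝕂 (Fin n)) = n := by simp
  have hm : Module.finrank 𝕂 (EuclideanSpace 𝕂 (Fin m)) = m := by simp
  set v := hTs.eigenvectorBasis hn with hv
  set ev := hTs.eigenvalues hn with hev
  have ha : Antitone ev := hTs.eigenvalues_antitone hn
  have hin : ∀ i j, inner 𝕂 (L (v i)) (L (v j)) = if i = j then (ev j : 𝕂) else 0 := by
    intro i j
    have h1 : inner 𝕂 (L (v i)) (L (v j)) = inner 𝕂 (v i) (T (v j)) := by
      rw [hT, LinearMap.comp_apply, LinearMap.adjoint_inner_right]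
    rw [h1, hTs.apply_eigenvectorBasis hn j, inner_smul_right,
      orthonormal_iff_ite.1 v.orthonormal i j]
    simp [hev]
  have h0 : ∀ i, 0 ≤ ev i := by
    intro i
    have h1 := hin i i
    rw [if_pos rfl, inner_self_eq_norm_sq_to_K] at h1
    have h2 : ‖L (v i)‖ ^ 2 = ev i := by exact_mod_cast h1
    rw [← h2]; positivity
  have hnull : ∀ i, ev i = 0 → L (v i) = 0 := by
    intro i hi
    have h1 := hin i i
    rw [if_pos rfl, hi] at h1
    exact inner_self_eq_zero.1 (h1.trans RCLike.ofReal_zero)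
  have hon : Orthonormal 𝕂 (fun i : {i : Fin n // ev i ≠ 0} =>
      ((√(ev i))⁻¹ : 𝕂) • L (v i)) := by
    rw [orthonormal_iff_ite]
    intro i j
    rw [inner_smul_left, inner_smul_right, hin]
    by_cases hij : i = j
    · subst hij
      have hs : √(ev i) ≠ 0 := (Real.sqrt_ne_zero (h0 i)).2 i.2
      have hs' : ((√(ev i) : ℝ) : 𝕂) ≠ 0 := by exact_mod_cast hs
      have hq : (ev i : 𝕂) = (√(ev i) : 𝕂) * (√(ev i) : 𝕂) := by
        exact_mod_cast (Real.mul_self_sqrt (h0 i)).symm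
      rw [if_pos rfl, if_pos rfl]
      simp only [map_inv₀, RCLike.conj_ofReal]
      rw [hq]
      field_simp
    · rw [if_neg (fun h => hij (Subtype.ext h)), if_neg hij]
      simp
  have hlt : ∀ i : Fin n, ev i ≠ 0 → i.val < m := by
    intro i hi
    by_contra! hmi
    have hpos : 0 < ev i := lt_of_le_of_ne (h0 i) (Ne.symm hi)
    have hle : i.val + 1 ≤ n := i.isLt
    let f : Fin (i.val + 1) → {i : Fin n // ev i ≠ 0} := fun t =>
      ⟨Fin.castLE hle t, (lt_of_lt_of_le hpos (ha (by
        rw [Fin.le_def]; simpa using Nat.lt_succ_iff.1 t.isLt))).ne'⟩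
    have hf : Function.Injective f := by
      intro s t hst
      have := congrArg (fun x => x.1.val) hst
      exact Fin.ext (by simpa [f] using this)
    have hc := (hon.linearIndependent.comp f hf).fintype_card_le_finrank
    rw [hm, Fintype.card_fin] at hc
    omega
  let u : Fin m → EuclideanSpace 𝕂 (Fin m) := fun i =>
    if h : i.val < n then ((√(ev ⟨i.val, h⟩))⁻¹ : 𝕂) • L (v ⟨i.val, h⟩) else 0
  let s : Set (Fin m) := {i | ∃ h : i.val < n, ev ⟨i.val, h⟩ ≠ 0}
  have hus : Orthonormal 𝕂 (s.domRestrict u) := by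
    let g : s → {i : Fin n // ev i ≠ 0} := fun i => ⟨⟨i.1.val, i.2.1⟩, i.2.2⟩
    have hg : Function.Injective g := by
      intro a b hab
      have := congrArg (fun x => x.1.val) hab
      exact Subtype.ext (Fin.ext (by simpa [g] using this))
    have h1 := hon.comp g hg
    convert h1 using 1
    funext i
    have : i.1.val < n := i.2.1
    simp [u, g, Set.domRestrict, this]
  obtain ⟨b, hb⟩ := hus.exists_orthonormalBasis_extension_of_card_eq (by simp)
  have hL' : ∀ j : Fin n, L (v j) =
      if h : j.val < m then (√(ev j) : 𝕂) • b ⟨j.val, h⟩ else 0 := by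
    intro j
    by_cases hj : ev j = 0
    · rw [hnull j hj]; simp [hj]
    · have hjm := hlt j hj
      have hs : √(ev j) ≠ 0 := (Real.sqrt_ne_zero (h0 j)).2 hj
      have hs' : ((√(ev j) : ℝ) : 𝕂) ≠ 0 := by exact_mod_cast hs
      rw [dif_pos hjm, hb ⟨j.val, hjm⟩ ⟨j.isLt, hj⟩]
      simp only [u, j.isLt, dif_pos, smul_smul]
      rw [mul_inv_cancel₀ hs', one_smul]
  let W : Matrix (Fin m) (Fin m) 𝕂 := fun i j => b j i
  let V : Matrix (Fin n) (Fin n) 𝕂 := fun i j => v j i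
  have hW : W ∈ Matrix.unitaryGroup (Fin m) 𝕂 := by
    rw [Matrix.mem_unitaryGroup_iff']
    ext i j
    have := orthonormal_iff_ite.1 b.orthonormal i j
    rw [Matrix.one_apply, ← this, Matrix.mul_apply, PiLp.inner_apply]
    exact Finset.sum_congr rfl fun x _ => mul_comm _ _
  have hV : V ∈ Matrix.unitaryGroup (Fin n) 𝕂 := by
    rw [Matrix.mem_unitaryGroup_iff']
    ext i j
    have := orthonormal_iff_ite.1 v.orthonormal i j
    rw [Matrix.one_apply, ← this, Matrix.mul_apply, PiLp.inner_apply]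
    exact Finset.sum_congr rfl fun x _ => mul_comm _ _
  let σ : Fin (min m n) → ℝ := fun t => √(ev ⟨t.val, lt_of_lt_of_le t.isLt (min_le_right _ _)⟩)
  have hAV : A * V = W * rectDiagonal 𝕂 σ := by
    ext i j
    have h1 : (A * V) i j = L (v j) i := by
      rw [Matrix.mul_apply]
      simp [hL, Matrix.toLpLin_apply, Matrix.mulVec, dotProduct, V]
    rw [h1, hL' j, Matrix.mul_apply]
    by_cases hj : j.val < m
    · rw [dif_pos hj, Finset.sum_eq_single (⟨j.val, hj⟩ : Fin m)]
      · simp [W, rectDiagonal, σ, Algebra.smul_def, mul_comm]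
      · intro t _ ht
        have : t.val ≠ j.val := fun h => ht (Fin.ext h)
        simp [rectDiagonal, this]
      · simp
    · rw [dif_neg hj, Finset.sum_eq_zero]
      · simp
      · intro t _
        have : t.val ≠ j.val := fun h => hj (h ▸ t.isLt)
        simp [rectDiagonal, this]
  refine ⟨⟨W, V, σ, hW, hV, ?_, fun _ => Real.sqrt_nonneg _, ?_⟩⟩
  · intro a c hac
    exact Real.sqrt_le_sqrt (ha (Fin.le_def.2 (Fin.le_def.1 hac)))
  · have hVV : V * Vᴴ = 1 := Matrix.mem_unitaryGroup_iff.1 hV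
    rw [← hAV, Matrix.mul_assoc, hVV, Matrix.mul_one]

/-- The column leverage score `p_j^{lev,k} = (1/k) ‖V_k(j,:)‖₂²`, where `V_k` consists of the
first `k` columns of `V`. -/
noncomputable def SVD.colLeverage {A : Matrix (Fin m) (Fin n) 𝕂} (S : SVD A) (k : ℕ)
    (j : Fin n) : ℝ :=
  (1 / (k : ℝ)) * ∑ t : Fin n with t.val < k, ‖S.V j t‖ ^ 2

/-- The row leverage score `q_i^{lev,k} = (1/k) ‖W_k(i,:)‖₂²`, where `W_k` consists of the
first `k` columns of `W`. -/
noncomputable def SVD.rowLeverage {A : Matrix (Fin m) (Fin n) 𝕂} (S : SVD A) (k : ℕ)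
    (i : Fin m) : ℝ :=
  (1 / (k : ℝ)) * ∑ t : Fin m with t.val < k, ‖S.W i t‖ ^ 2

end Leverage

/-- The joint law of `ℓ` indices drawn independently, with replacement, from `p`. -/
noncomputable def sampleLaw {n : ℕ} (p : PMF (Fin n)) (ℓ : ℕ) :
    MeasureTheory.Measure (Fin ℓ → Fin n) :=
  MeasureTheory.Measure.pi fun _ => p.toMeasure

end CURSampling

/-! The identity is exact as soon as the sampled rows of `V_k` and of `W_k` each span `𝕂^k`. In that
case `A = C Y` and `A = X R`, hence `C = X U`, `R = U Y`, and `C U† R = X (U U† U) Y = X U Y = A`;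
only the first Penrose equation is used.

Spanning is controlled by expected codimension rather than by matrix concentration. The rows `v_i`
of `V_k` form a Parseval frame and `v_i` is drawn with probability at least `c ‖v_i‖²`, where `c = β
/ k`. Hence a draw leaves a given subspace `T` with probability at least `c · codim T`, and each
draw multiplies the expected codimension by at most `1 - c`. After `ℓ` draws it is at most `(1 -
c)^ℓ k`, which by Markov's inequality bounds the probability of not spanning. Independence of the
column and row draws gives the square. -/

namespace CURSampling

/-! ### Exactness from spanning leading rows -/

section Deterministic

variable {𝕂 : Type*} [RCLike 𝕂]

/-- If the sampled columns and the sampled rows generate all columns and all rows of `A`, then the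
CUR decomposition is exact. -/
theorem eq_mul_pinv_mul_of_factor {m n r c : Type*} [Fintype m] [Fintype n] [Fintype r] [Fintype c]
    (A : Matrix m n 𝕂) (J : c → n) (I : r → m) (X : Matrix m r 𝕂) (Y : Matrix c n 𝕂)
    (hY : A = A.submatrix id J * Y) (hX : A = X * A.submatrix I id) :
    A = A.submatrix id J * pinv (A.submatrix I J) * A.submatrix I id := by
  have hC : A.submatrix id J = X * A.submatrix I J := by
    ext i j
    exact congrFun (congrFun hX i) (J j)
  have hR : A.submatrix I id = A.submatrix I J * Y := by
    ext i j
    exact congrFun (congrFun hY (I i)) j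
  have hU := (pinv_spec (A.submatrix I J)).mul_mul_left
  calc A = X * (A.submatrix I J * Y) := by rw [← hR, ← hX]
    _ = X * (A.submatrix I J * pinv (A.submatrix I J) * A.submatrix I J) * Y := by
        rw [hU, Matrix.mul_assoc]
    _ = X * A.submatrix I J * pinv (A.submatrix I J) * (A.submatrix I J * Y) := by
        simp only [Matrix.mul_assoc]
    _ = _ := by rw [← hC, ← hR]

variable {m n k : ℕ}

/-- By monotonicity, a nonzero `σ t` makes all earlier singular values nonzero, so `Σ` contains an
invertible diagonal block of size `t + 1`, exceeding the rank. -/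
theorem SVD.σ_eq_zero {A : Matrix (Fin m) (Fin n) 𝕂} (S : SVD A) (t : Fin (min m n))
    (ht : A.rank ≤ t.val) : S.σ t = 0 := by
  classical
  by_contra hne
  have hrank : (rectDiagonal 𝕂 S.σ).rank = A.rank := by
    have hW : IsUnit S.W.det := (Matrix.isUnit_iff_isUnit_det _).1
      (Unitary.isUnit_coe (U := ⟨S.W, S.W_unitary⟩))
    have hV : IsUnit S.Vᴴ.det := (Matrix.isUnit_iff_isUnit_det _).1
      (Unitary.isUnit_coe (U := star ⟨S.V, S.V_unitary⟩))
    conv_rhs => rw [S.eq_mul, Matrix.rank_mul_eq_left_of_isUnit_det _ _ hV,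
      Matrix.rank_mul_eq_right_of_isUnit_det _ _ hW]
  have hm : t.val + 1 ≤ m := lt_of_lt_of_le t.isLt (min_le_left _ _)
  have hn : t.val + 1 ≤ n := lt_of_lt_of_le t.isLt (min_le_right _ _)
  have hsub : (rectDiagonal 𝕂 S.σ).submatrix (Fin.castLE hm) (Fin.castLE hn)
      = Matrix.diagonal fun s : Fin (t.val + 1) => ((S.σ (Fin.castLE t.isLt s) : ℝ) : 𝕂) := by
    ext i j
    by_cases hij : i = j
    · subst hij
      simp [rectDiagonal, Fin.castLE]
    · have : i.val ≠ j.val := fun h => hij (Fin.ext h)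
      simp [rectDiagonal, this, hij]
  have hle := Matrix.rank_submatrix_le (rectDiagonal 𝕂 S.σ) (Fin.castLE hm) (Fin.castLE hn)
  have hpos : ∀ s : Fin (t.val + 1), ((S.σ (Fin.castLE t.isLt s) : ℝ) : 𝕂) ≠ 0 := by
    intro s
    have h1 : S.σ t ≤ S.σ (Fin.castLE t.isLt s) :=
      S.σ_antitone (Fin.le_def.2 (Nat.lt_succ_iff.1 s.isLt))
    have h2 : 0 < S.σ t := lt_of_le_of_ne (S.σ_nonneg t) (Ne.symm hne)
    exact_mod_cast (h2.trans_le h1).ne'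
  rw [hsub, hrank, Matrix.rank_of_isUnit _ ((Matrix.isUnit_iff_isUnit_det _).2 (by
    rw [Matrix.det_diagonal, isUnit_iff_ne_zero]
    exact Finset.prod_ne_zero_iff.2 fun s _ => hpos s)), Fintype.card_fin] at hle
  omega

/-- The rows of the first `k` columns of a square matrix. -/
noncomputable def leadingRow {N : ℕ} (B : Matrix (Fin N) (Fin N) 𝕂) (k : ℕ) (i : Fin N) :
    EuclideanSpace 𝕂 {t : Fin N // t.val < k} :=
  WithLp.toLp 2 fun t => B i t

theorem exists_coeff_of_span_eq_top {N ℓ : ℕ} (B : Matrix (Fin N) (Fin N) 𝕂) (J : Fin ℓ → Fin N)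
    (h : Submodule.span 𝕂 (Set.range fun s => leadingRow B k (J s)) = ⊤) :
    ∃ c : Matrix (Fin N) (Fin ℓ) 𝕂, ∀ i (t : Fin N), t.val < k →
      B i t = ∑ s, c i s * B (J s) t := by
  have key : ∀ i, ∃ c : Fin ℓ → 𝕂, ∑ s, c s • leadingRow B k (J s) = leadingRow B k i := fun i =>
    (Submodule.mem_span_range_iff_exists_fun 𝕂).1 (h ▸ Submodule.mem_top)
  choose c hc using key
  refine ⟨c, fun i t ht => ?_⟩
  have := congrArg (fun x : EuclideanSpace 𝕂 {t : Fin N // t.val < k} => x ⟨t, ht⟩) (hc i)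
  simpa [leadingRow] using this.symm

/-- Columns of `WΣ` from index `k` on vanish, so linear relations among the leading rows of `V` pass
to the columns of `A`. -/
theorem SVD.exists_col_factor {A : Matrix (Fin m) (Fin n) 𝕂} (S : SVD A) (hA : A.rank = k) {ℓ : ℕ}
    (J : Fin ℓ → Fin n)
    (h : Submodule.span 𝕂 (Set.range fun s => leadingRow S.V k (J s)) = ⊤) :
    ∃ Y : Matrix (Fin ℓ) (Fin n) 𝕂, A = A.submatrix id J * Y := by
  obtain ⟨c, hc⟩ := exists_coeff_of_span_eq_top S.V J h
  have hB : ∀ i t, k ≤ t.val → (S.W * rectDiagonal 𝕂 S.σ) i t = 0 := by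
    intro i t ht
    rw [Matrix.mul_apply]
    refine Finset.sum_eq_zero fun s _ => ?_
    by_cases hst : s.val = t.val
    · simp [rectDiagonal, hst, S.σ_eq_zero ⟨t.val, lt_min (hst ▸ s.isLt) t.isLt⟩ (hA.trans_le ht)]
    · simp [rectDiagonal, hst]
  have hAe : ∀ i j, A i j = ∑ t, (S.W * rectDiagonal 𝕂 S.σ) i t * star (S.V j t) := fun i j => by
    conv_lhs => rw [S.eq_mul, Matrix.mul_apply]
    rfl
  -- The rows of `V` enter `A = (WΣ)V*` conjugated, hence so do their coefficients.
  refine ⟨cᴴ, ?_⟩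
  ext i j
  rw [Matrix.mul_apply, hAe]
  simp only [Matrix.submatrix_apply, id, hAe, Matrix.conjTranspose_apply, Finset.sum_mul]
  rw [Finset.sum_comm]
  refine Finset.sum_congr rfl fun t _ => ?_
  by_cases ht : t.val < k
  · rw [hc j t ht, star_sum, Finset.mul_sum]
    exact Finset.sum_congr rfl fun s _ => by rw [star_mul', mul_comm (star (c j s)), mul_assoc]
  · simp [hB i t (not_lt.1 ht)]

theorem SVD.exists_row_factor {A : Matrix (Fin m) (Fin n) 𝕂} (S : SVD A) (hA : A.rank = k) {ℓ : ℕ}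
    (I : Fin ℓ → Fin m)
    (h : Submodule.span 𝕂 (Set.range fun s => leadingRow S.W k (I s)) = ⊤) :
    ∃ X : Matrix (Fin m) (Fin ℓ) 𝕂, A = X * A.submatrix I id := by
  obtain ⟨c, hc⟩ := exists_coeff_of_span_eq_top S.W I h
  have hB : ∀ t j, k ≤ t.val → (rectDiagonal 𝕂 S.σ * S.Vᴴ) t j = 0 := by
    intro t j ht
    rw [Matrix.mul_apply]
    refine Finset.sum_eq_zero fun s _ => ?_
    by_cases hst : t.val = s.val
    · simp [rectDiagonal, hst,
        S.σ_eq_zero ⟨s.val, lt_min (hst ▸ t.isLt) s.isLt⟩ (hA.trans_le (hst ▸ ht))]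
    · simp [rectDiagonal, hst]
  have hAe : ∀ i j, A i j = ∑ t, S.W i t * (rectDiagonal 𝕂 S.σ * S.Vᴴ) t j := fun i j => by
    conv_lhs => rw [S.eq_mul, Matrix.mul_assoc, Matrix.mul_apply]
  refine ⟨c, ?_⟩
  ext i j
  rw [Matrix.mul_apply, hAe]
  simp only [Matrix.submatrix_apply, id, hAe, Finset.mul_sum]
  rw [Finset.sum_comm]
  refine Finset.sum_congr rfl fun t _ => ?_
  by_cases ht : t.val < k
  · rw [hc i t ht, Finset.sum_mul]
    exact Finset.sum_congr rfl fun s _ => mul_assoc _ _ _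
  · simp [hB t j (not_lt.1 ht)]

/-- The leading rows of a unitary matrix form a Parseval frame. -/
theorem sum_norm_inner_leadingRow_sq {N : ℕ} {B : Matrix (Fin N) (Fin N) 𝕂}
    (hB : B ∈ Matrix.unitaryGroup (Fin N) 𝕂) (k : ℕ)
    (x : EuclideanSpace 𝕂 {t : Fin N // t.val < k}) :
    ∑ i, ‖inner 𝕂 x (leadingRow B k i)‖ ^ 2 = ‖x‖ ^ 2 := by
  classical
  have hBB : Bᴴ * B = 1 := Matrix.mem_unitaryGroup_iff'.1 hB
  have hBt : ∀ s t : {t : Fin N // t.val < k},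
      ∑ i, star (B i s) * B i t = if s = t then 1 else 0 := by
    intro s t
    have := congrFun (congrFun hBB s.1) t.1
    simpa [Matrix.mul_apply, Matrix.one_apply, Subtype.ext_iff] using this
  have hx : ∀ i, inner 𝕂 x (leadingRow B k i)
      = ∑ t : {t : Fin N // t.val < k}, B i t * star (x t) := fun i => by
    simp [PiLp.inner_apply, leadingRow]
  have hK : ∑ i, star (inner 𝕂 x (leadingRow B k i)) * inner 𝕂 x (leadingRow B k i)
      = ∑ t, star (x t) * x t := by
    simp only [hx, star_sum, star_mul', star_star, Finset.sum_mul_sum]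
    rw [Finset.sum_comm]
    refine Finset.sum_congr rfl fun s _ => ?_
    rw [Finset.sum_comm]
    calc _ = ∑ t : {t : Fin N // t.val < k}, (∑ i, star (B i s) * B i t) * (x s * star (x t)) :=
          Finset.sum_congr rfl fun t _ => by
            rw [Finset.sum_mul]; exact Finset.sum_congr rfl fun i _ => by ring
      _ = _ := by simp only [hBt]; simp [mul_comm]
  have hs : ∀ z : 𝕂, star z * z = ((‖z‖ ^ 2 : ℝ) : 𝕂) := fun z => by
    rw [RCLike.star_def, RCLike.conj_mul]; push_cast; rfl
  simp only [hs] at hK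
  rw [EuclideanSpace.norm_sq_eq]
  exact_mod_cast hK

end Deterministic

/-! ### Expected codimension of a random span -/

section Sampling

open MeasureTheory Module

variable {𝕂 : Type*} [RCLike 𝕂] {E : Type*} [NormedAddCommGroup E] [InnerProductSpace 𝕂 E]
  [FiniteDimensional 𝕂 E] {n : ℕ}

/-- The codimension of a subspace, as a real number. -/
noncomputable def codim (T : Submodule 𝕂 E) : ℝ := (finrank 𝕂 E : ℝ) - finrank 𝕂 T

/-- Sum the Parseval identity over an orthonormal basis of `Tᗮ` and exchange the sums: vectors in
`T` contribute nothing, the others at most `‖v i‖ ^ 2` by Bessel. -/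
theorem finrank_orthogonal_le_sum_norm_sq {v : Fin n → E}
    (hv : ∀ x, ∑ i, ‖inner 𝕂 x (v i)‖ ^ 2 = ‖x‖ ^ 2) (T : Submodule 𝕂 E)
    [DecidablePred fun i => v i ∈ T] :
    (finrank 𝕂 Tᗮ : ℝ) ≤ ∑ i, if v i ∈ T then 0 else ‖v i‖ ^ 2 := by
  let b := stdOrthonormalBasis 𝕂 Tᗮ
  have hb : Orthonormal 𝕂 fun s => (b s : E) :=
    b.orthonormal.comp_linearIsometry Tᗮ.subtypeₗᵢ
  calc (finrank 𝕂 Tᗮ : ℝ) = ∑ s, ∑ i, ‖inner 𝕂 (b s : E) (v i)‖ ^ 2 := by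
        simp [hv, hb.1]
    _ = ∑ i, ∑ s, ‖inner 𝕂 (b s : E) (v i)‖ ^ 2 := Finset.sum_comm
    _ ≤ _ := Finset.sum_le_sum fun i _ => by
        split_ifs with hi
        · exact (Finset.sum_eq_zero fun s _ => by
            rw [Submodule.inner_left_of_mem_orthogonal hi (b s).2]; simp).le
        · exact hb.sum_inner_products_le (v i)

/-- Adding one random vector to a subspace shrinks its expected codimension geometrically. -/
theorem sum_mul_codim_sup_span_le {v : Fin n → E}
    (hv : ∀ x, ∑ i, ‖inner 𝕂 x (v i)‖ ^ 2 = ‖x‖ ^ 2) {w : Fin n → ℝ} (hw : ∑ i, w i = 1)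
    {c : ℝ} (hc : 0 ≤ c) (hcw : ∀ i, c * ‖v i‖ ^ 2 ≤ w i) (T : Submodule 𝕂 E) :
    ∑ i, w i * codim (T ⊔ Submodule.span 𝕂 {v i})
      ≤ (1 - c) * codim T := by
  classical
  have hw0 : ∀ i, 0 ≤ w i := fun i => (by positivity : (0:ℝ) ≤ c * ‖v i‖ ^ 2).trans (hcw i)
  have hdim : ∀ i, (finrank 𝕂 T : ℝ) + (if v i ∈ T then 0 else 1)
      ≤ finrank 𝕂 ↥(T ⊔ Submodule.span 𝕂 {v i}) := by
    intro i
    split_ifs with hi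
    · rw [add_zero]
      exact_mod_cast Submodule.finrank_mono le_sup_left
    · have : T < T ⊔ Submodule.span 𝕂 {v i} := by
        refine lt_of_le_of_ne le_sup_left fun h => hi ?_
        rw [h]
        exact Submodule.mem_sup_right (Submodule.mem_span_singleton_self _)
      exact_mod_cast Submodule.finrank_lt_finrank_of_lt this
  have horth : (finrank 𝕂 Tᗮ : ℝ) = codim T := by
    rw [codim, ← T.finrank_add_finrank_orthogonal]; push_cast; ring
  -- The right side is the probability that the draw falls outside `T`, in which case the
  -- codimension drops by at least one.
  have h1 : c * (finrank 𝕂 Tᗮ : ℝ) ≤ ∑ i, w i * (if v i ∈ T then 0 else 1) := by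
    refine (mul_le_mul_of_nonneg_left (finrank_orthogonal_le_sum_norm_sq hv T) hc).trans ?_
    rw [Finset.mul_sum]
    refine Finset.sum_le_sum fun i _ => ?_
    split_ifs
    · simp
    · simpa using hcw i
  calc _ ≤ ∑ i, w i * (codim T - if v i ∈ T then 0 else 1) :=
        Finset.sum_le_sum fun i _ => mul_le_mul_of_nonneg_left (by
          unfold codim; linarith [hdim i]) (hw0 i)
    _ = codim T - ∑ i, w i * (if v i ∈ T then 0 else 1) := by
        simp only [mul_sub, Finset.sum_sub_distrib, ← Finset.sum_mul, hw, one_mul]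
    _ ≤ _ := by rw [horth] at h1; linarith

/-- Condition on the first draw and absorb it into `T`; this is why the induction runs over all `T`.
-/
theorem sum_prod_mul_codim_le {v : Fin n → E}
    (hv : ∀ x, ∑ i, ‖inner 𝕂 x (v i)‖ ^ 2 = ‖x‖ ^ 2) {w : Fin n → ℝ} (hw : ∑ i, w i = 1)
    {c : ℝ} (hc : 0 ≤ c) (hc1 : c ≤ 1) (hcw : ∀ i, c * ‖v i‖ ^ 2 ≤ w i) (ℓ : ℕ)
    (T : Submodule 𝕂 E) :
    ∑ J : Fin ℓ → Fin n, (∏ s, w (J s)) * codim (T ⊔ Submodule.span 𝕂 (Set.range fun s => v (J s)))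
      ≤ (1 - c) ^ ℓ * codim T := by
  have hw0 : ∀ i, 0 ≤ w i := fun i => (by positivity : (0:ℝ) ≤ c * ‖v i‖ ^ 2).trans (hcw i)
  induction ℓ generalizing T with
  | zero =>
    have h : ∀ J : Fin 0 → Fin n, (Set.range fun s => v (J s)) = ∅ := fun _ => Set.range_eq_empty _
    simp [h]
  | succ ℓ ih =>
    have hspan : ∀ (i : Fin n) (J : Fin ℓ → Fin n),
        T ⊔ Submodule.span 𝕂 (Set.range fun s => v ((Fin.cons i J : Fin (ℓ + 1) → Fin n) s))
          = T ⊔ Submodule.span 𝕂 {v i} ⊔ Submodule.span 𝕂 (Set.range fun s => v (J s)) := by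
      intro i J
      have : (fun s => v ((Fin.cons i J : Fin (ℓ + 1) → Fin n) s))
          = Fin.cons (v i) fun s => v (J s) := by
        funext s; refine Fin.cases ?_ (fun s => ?_) s <;> simp
      rw [this, Fin.range_cons, Submodule.span_insert, sup_assoc]
    rw [← (Fin.consEquiv fun _ => Fin n).sum_comp, Fintype.sum_prod_type]
    have happ : ∀ x : Fin n × (Fin ℓ → Fin n),
        Fin.consEquiv (fun _ => Fin n) x = Fin.cons x.1 x.2 := fun _ => rfl
    simp only [happ, Fin.prod_univ_succ, Fin.cons_zero, Fin.cons_succ, hspan,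
      mul_assoc, ← Finset.mul_sum]
    calc _ ≤ ∑ i, w i * ((1 - c) ^ ℓ * codim (T ⊔ Submodule.span 𝕂 {v i})) :=
          Finset.sum_le_sum fun i _ => mul_le_mul_of_nonneg_left (ih _) (hw0 i)
      _ = (1 - c) ^ ℓ * ∑ i, w i * codim (T ⊔ Submodule.span 𝕂 {v i}) := by
          rw [Finset.mul_sum]; exact Finset.sum_congr rfl fun i _ => by ring
      _ ≤ (1 - c) ^ ℓ * ((1 - c) * codim T) :=
          mul_le_mul_of_nonneg_left (sum_mul_codim_sup_span_le hv hw hc hcw T)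
            (pow_nonneg (sub_nonneg.2 hc1) ℓ)
      _ = _ := by ring

theorem sum_toReal_pmf (p : PMF (Fin n)) : ∑ i, (p i).toReal = 1 := by
  rw [← ENNReal.toReal_sum fun i _ => p.apply_ne_top i, ← tsum_fintype (L := .unconditional _),
    p.tsum_coe, ENNReal.toReal_one]

instance (p : PMF (Fin n)) (ℓ : ℕ) : IsProbabilityMeasure (sampleLaw p ℓ) := by
  unfold sampleLaw; infer_instance

theorem sampleLaw_real_singleton (p : PMF (Fin n)) {ℓ : ℕ} (J : Fin ℓ → Fin n) :
    (sampleLaw p ℓ).real {J} = ∏ s, (p (J s)).toReal := by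
  rw [Measure.real, sampleLaw, Measure.pi_singleton, ENNReal.toReal_prod]
  simp

/-- Markov's inequality: the codimension is at least one whenever the span is proper. -/
theorem one_sub_le_sampleLaw_real_span_eq_top {v : Fin n → E}
    (hv : ∀ x, ∑ i, ‖inner 𝕂 x (v i)‖ ^ 2 = ‖x‖ ^ 2) (p : PMF (Fin n))
    {c : ℝ} (hc : 0 ≤ c) (hc1 : c ≤ 1) (hcw : ∀ i, c * ‖v i‖ ^ 2 ≤ (p i).toReal) (ℓ : ℕ) :
    1 - (1 - c) ^ ℓ * finrank 𝕂 E
      ≤ (sampleLaw p ℓ).real {J | Submodule.span 𝕂 (Set.range fun s => v (J s)) = ⊤} := by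
  classical
  have h := sum_prod_mul_codim_le hv (sum_toReal_pmf p) hc hc1 hcw ℓ ⊥
  rw [show codim (⊥ : Submodule 𝕂 E) = finrank 𝕂 E by simp [codim]] at h
  simp only [bot_sup_eq] at h
  have hone : ∑ J : Fin ℓ → Fin n, ∏ s, (p (J s)).toReal = 1 := by
    simp only [← sampleLaw_real_singleton, sum_measureReal_singleton]
    simp
  have hset : (sampleLaw p ℓ).real {J | Submodule.span 𝕂 (Set.range fun s => v (J s)) = ⊤}
      = ∑ J : Fin ℓ → Fin n,
        if Submodule.span 𝕂 (Set.range fun s => v (J s)) = ⊤ then ∏ s, (p (J s)).toReal else 0 := by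
    rw [← Finset.sum_filter]
    simp only [← sampleLaw_real_singleton, sum_measureReal_singleton]
    congr 1
    ext J; simp
  rw [hset]
  refine le_trans (sub_le_sub_left h 1) ?_
  rw [← hone, ← Finset.sum_sub_distrib]
  refine Finset.sum_le_sum fun J _ => ?_
  have hw0 : 0 ≤ ∏ s, (p (J s)).toReal := Finset.prod_nonneg fun _ _ => ENNReal.toReal_nonneg
  split_ifs with hJ
  · rw [hJ, codim, finrank_top]; simp
  · have h1 : (finrank 𝕂 ↥(Submodule.span 𝕂 (Set.range fun s => v (J s))) : ℝ) + 1
        ≤ finrank 𝕂 E := by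
      exact_mod_cast Submodule.finrank_lt hJ
    have h2 : 1 ≤ codim (Submodule.span 𝕂 (Set.range fun s => v (J s))) := by
      unfold codim; linarith
    nlinarith

theorem pow_mul_le_two_mul_exp {k ℓ : ℕ} {β δ : ℝ} (hδ : 0 < δ) (hβ : β ∈ Set.Ioc (0 : ℝ) 1)
    (hℓ : 8 / β * (Real.log (2 * k) + 1 / δ) * k ≤ ℓ) :
    (1 - β / k) ^ ℓ * k ≤ 2 * Real.exp (-(1 / δ)) := by
  rcases Nat.eq_zero_or_pos k with rfl | hk
  · simp; positivity
  have hk1 : (1 : ℝ) ≤ k := by exact_mod_cast hk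
  have hk0 : (0 : ℝ) < k := by linarith
  have hβ0 := hβ.1
  have hlog : 0 ≤ Real.log (2 * k) := Real.log_nonneg (by linarith)
  have hd : 0 < 1 / δ := by positivity
  have h0 : 0 ≤ 1 - β / k := sub_nonneg.2 ((div_le_one hk0).2 (hβ.2.trans hk1))
  -- The factor 8 is pure slack here: this exponent already yields `exp (-(1 / δ)) / 2`.
  have hexp : Real.log (2 * k) + 1 / δ ≤ β / k * ℓ := by
    have : β / k * (8 / β * (Real.log (2 * k) + 1 / δ) * k) ≤ β / k * ℓ :=
      mul_le_mul_of_nonneg_left hℓ (by positivity)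
    have e : β / k * (8 / β * (Real.log (2 * k) + 1 / δ) * k)
        = 8 * (Real.log (2 * k) + 1 / δ) := by field_simp
    linarith
  have h1 : (1 - β / k) ^ ℓ ≤ Real.exp (-(β / k * ℓ)) := by
    calc (1 - β / k) ^ ℓ ≤ Real.exp (-(β / k)) ^ ℓ :=
          pow_le_pow_left₀ h0 (Real.one_sub_le_exp_neg _) ℓ
      _ = _ := by rw [← Real.exp_nat_mul]; ring_nf
  have h2 : Real.exp (-(β / k * ℓ)) ≤ (2 * k : ℝ)⁻¹ * Real.exp (-(1 / δ)) := by
    rw [← Real.exp_log (show (0 : ℝ) < (2 * k : ℝ)⁻¹ by positivity), ← Real.exp_add, Real.log_inv]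
    exact Real.exp_le_exp.2 (by linarith)
  calc (1 - β / k) ^ ℓ * k ≤ (2 * k : ℝ)⁻¹ * Real.exp (-(1 / δ)) * k :=
        mul_le_mul_of_nonneg_right (h1.trans h2) hk0.le
    _ = 1 / 2 * Real.exp (-(1 / δ)) := by field_simp
    _ ≤ _ := by linarith [Real.exp_pos (-(1 / δ))]

theorem le_sampleLaw_real_leadingRow_span_eq_top {N k ℓ : ℕ} {B : Matrix (Fin N) (Fin N) 𝕂}
    (hB : B ∈ Matrix.unitaryGroup (Fin N) 𝕂) {β δ : ℝ} (hδ : 0 < δ) (hβ : β ∈ Set.Ioc (0 : ℝ) 1)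
    (p : PMF (Fin N))
    (hp : ∀ i, β * ((1 / (k : ℝ)) * ∑ t : Fin N with t.val < k, ‖B i t‖ ^ 2) ≤ (p i).toReal)
    (hℓ : 8 / β * (Real.log (2 * k) + 1 / δ) * k ≤ ℓ) :
    1 - 2 * Real.exp (-(1 / δ)) ≤ (sampleLaw p ℓ).real
      {J | Submodule.span 𝕂 (Set.range fun s => leadingRow B k (J s)) = ⊤} := by
  have hc : 0 ≤ β / k := div_nonneg hβ.1.le k.cast_nonneg
  have hc1 : β / k ≤ 1 := by
    rcases Nat.eq_zero_or_pos k with rfl | hk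
    · simp
    · have hk1 : (1 : ℝ) ≤ k := by exact_mod_cast hk
      exact (div_le_one (by linarith)).2 (hβ.2.trans hk1)
  have hcw : ∀ i, β / k * ‖leadingRow B k i‖ ^ 2 ≤ (p i).toReal := by
    intro i
    refine le_of_eq_of_le ?_ (hp i)
    rw [EuclideanSpace.norm_sq_eq, ← Finset.sum_subtype_eq_sum_filter, ← mul_assoc, mul_one_div]
    congr 1
    refine Finset.sum_congr ?_ fun t _ => rfl
    ext t; simp
  -- Equality would require `k ≤ N`; the upper bound is enough.
  have hfin : (finrank 𝕂 (EuclideanSpace 𝕂 {t : Fin N // t.val < k}) : ℝ) ≤ k := by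
    rw [finrank_euclideanSpace]
    have := Fintype.card_le_of_injective
      (fun t : {t : Fin N // t.val < k} => (⟨t.1.val, t.2⟩ : Fin k))
      fun s t h => Subtype.ext (Fin.ext (congrArg (fun x => x.val) h))
    exact_mod_cast this.trans_eq (Fintype.card_fin k)
  refine le_trans ?_ (one_sub_le_sampleLaw_real_span_eq_top
    (sum_norm_inner_leadingRow_sq hB k) p hc hc1 hcw ℓ)
  have := mul_le_mul_of_nonneg_left hfin (pow_nonneg (sub_nonneg.2 hc1) ℓ)
  linarith [pow_mul_le_two_mul_exp hδ hβ hℓ]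

end Sampling

end CURSampling

theorem mainTheorem4 {𝕂 : Type*} [RCLike 𝕂] {m n k : ℕ}
    (A : Matrix (Fin m) (Fin n) 𝕂) (hA : A.rank = k) (S : CURSampling.SVD A)
    (δ β₁ β₂ : ℝ) (hδ : δ ∈ Set.Ioo (0 : ℝ) 1)
    (hβ₁ : β₁ ∈ Set.Ioc (0 : ℝ) 1) (hβ₂ : β₂ ∈ Set.Ioc (0 : ℝ) 1)
    (p : PMF (Fin n)) (q : PMF (Fin m))
    (hp : ∀ j, β₁ * S.colLeverage k j ≤ (p j).toReal)
    (hq : ∀ i, β₂ * S.rowLeverage k i ≤ (q i).toReal)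
    (ℓ₁ ℓ₂ : ℕ)
    (hℓ₁ : 8 / β₁ * (Real.log (2 * k) + 1 / δ) * k ≤ ℓ₁)
    (hℓ₂ : 8 / β₂ * (Real.log (2 * k) + 1 / δ) * k ≤ ℓ₂) :
    (1 - 2 * Real.exp (-(1 / δ))) ^ 2 ≤
      ((CURSampling.sampleLaw p ℓ₁).prod (CURSampling.sampleLaw q ℓ₂)).real
        {ω : (Fin ℓ₁ → Fin n) × (Fin ℓ₂ → Fin m) |
          A = A.submatrix id ω.1 * CURSampling.pinv (A.submatrix ω.2 ω.1) *
            A.submatrix ω.2 id} := by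
  -- Nonnegativity lets the two lower bounds be multiplied; it holds since `δ < 1` and `e > 2`.
  have hnn : 0 ≤ 1 - 2 * Real.exp (-(1 / δ)) := by
    have h1 : Real.exp (-(1 / δ)) ≤ Real.exp (-1) :=
      Real.exp_le_exp.2 (neg_le_neg ((one_le_div hδ.1).2 hδ.2.le))
    have h2 : Real.exp (-1) < 1 / 2 := by
      rw [Real.exp_neg, inv_lt_comm₀ (Real.exp_pos 1) (by norm_num)]
      linarith [Real.exp_one_gt_d9]
    linarith
  have h1 := CURSampling.le_sampleLaw_real_leadingRow_span_eq_top S.V_unitary hδ.1 hβ₁ p hp hℓ₁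
  have h2 := CURSampling.le_sampleLaw_real_leadingRow_span_eq_top S.W_unitary hδ.1 hβ₂ q hq hℓ₂
  rw [sq]
  refine (mul_le_mul h1 h2 hnn (hnn.trans h1)).trans ?_
  rw [← MeasureTheory.measureReal_prod_prod]
  refine MeasureTheory.measureReal_mono ?_
  rintro ω ⟨hJ, hI⟩
  obtain ⟨Y, hY⟩ := S.exists_col_factor hA ω.1 hJ
  obtain ⟨X, hX⟩ := S.exists_row_factor hA ω.2 hI
  exact CURSampling.eq_mul_pinv_mul_of_factor A ω.1 ω.2 X Y hY hX
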